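/- By a system $(X,T)$ we mean a nonempty compact metric space $(X,\rho)$ with a homeomorphism $T:X\to X$; orbits are the two-sided orbits $\{T^nx:n\in\mathbb Z\}$. The system is minimal if every orbit is dense. It is transitive if for all nonempty open $U,V$ there is $n\in\mathbb Z$ with $U\cap T^{-n}V\ne\emptyset$. A point is minimal if its orbit closure is a minimal system. A subsystem is a nonempty closed set $Z$ with $TZ=Z$, together with the restriction of $T$; it is an M-subsystem if it is transitive and its minimal points are dense in it. An extension $\pi:(X,T)\to(Y,S)$ is a continuous surjection with $\pi T=S\pi$. It is proximal if $\liminf_{n\to\infty}\rho(T^nx_1,T^nx_2)=0$ whenever $\pi(x_1)=\pi(x_2)$. It is equicontinuous if for every $\varepsilon>0$ there is $\delta>0$ such that $\pi(x_1)=\pi(x_2)$ and $\rho(x_1,x_2)<\delta$ imply $\rho(T^nx_1,T^nx_2)<\varepsilon$ for all $n\in\mathbb Z$. A minimal system $(X,T)$ is strictly PI if there are an ordinal $\eta$ and a family of pointed systems $(W_\iota,w_\iota)_{\iota\le\eta}$, with compatible base-point preserving extensions $W_\kappa\to W_\iota$ for $\iota\le\kappa\le\eta$, such that $W_0$ is the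 one-point system, each extension $W_{\iota+1}\to W_\iota$ ($\iota<\eta$) is proximal or equicontinuous, $W_\nu$ is the inverse limit of $(W_\iota)_{\iota<\nu}$ for each limit ordinal $\nu\le\eta$, and $W_\eta$ is isomorphic to $X$. A system $(X,T)$ is PI if there are a strictly PI system $\tilde X$ and a proximal extension $\tilde X\to X$. Theorem C. Let $(X,T)$ be a minimal PI system, let $d\ge2$, and let $\tau_d=T\times T^2\times\cdots\times T^d$ on $X^d$. Then every M-subsystem of $(X^d,\tau_d)$ is minimal. -/

import Mathlib

open Filter Topology

universe u

/-! Orbits, minimality and transitivity for a homeomorphism `T` of a topological space, under the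
action `n ↦ T ^ n` of `ℤ` (the group structure on `X ≃ₜ X` is composition). -/

/-- The two-sided orbit of `x` under `T`. -/
def zOrbit {X : Type*} [TopologicalSpace X] (T : X ≃ₜ X) (x : X) : Set X :=
  {y | ∃ n : ℤ, (T ^ n) x = y}

/-- A subsystem of `(X, T)`: a nonempty closed set `Z` with `T Z = Z`. -/
structure IsSubsystem {X : Type*} [TopologicalSpace X] (T : X ≃ₜ X) (Z : Set X) : Prop where
  nonempty : Z.Nonempty
  isClosed : IsClosed Z
  image_eq : T '' Z = Z

/-- The subsystem `(Z, T)` is minimal: every orbit in `Z` is dense in `Z`. -/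
structure IsMinimalSubsystem {X : Type*} [TopologicalSpace X] (T : X ≃ₜ X) (Z : Set X) : Prop
    extends IsSubsystem T Z where
  dense_orbit : ∀ x ∈ Z, Z ⊆ closure (zOrbit T x)

/-- A minimal point: its orbit closure is a minimal subsystem. -/
def IsMinimalPoint {X : Type*} [TopologicalSpace X] (T : X ≃ₜ X) (x : X) : Prop :=
  IsMinimalSubsystem T (closure (zOrbit T x))

/-- The subsystem `(Z, T)` is transitive. The nonempty open subsets of `Z` are the nonempty sets
`U ∩ Z` with `U` open in `X`. -/
def IsTransitiveOn {X : Type*} [TopologicalSpace X] (T : X ≃ₜ X) (Z : Set X) : Prop :=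
  ∀ U V : Set X, IsOpen U → IsOpen V → (U ∩ Z).Nonempty → (V ∩ Z).Nonempty →
    ∃ n : ℤ, ∃ x ∈ U ∩ Z, (T ^ n) x ∈ V ∩ Z

/-- An M-subsystem of `(X, T)`: a subsystem which is transitive and in which the minimal points
are dense. -/
structure IsMSubsystem {X : Type*} [TopologicalSpace X] (T : X ≃ₜ X) (Z : Set X) : Prop
    extends IsSubsystem T Z where
  transitive : IsTransitiveOn T Z
  dense_minimal : Z ⊆ closure {x | x ∈ Z ∧ IsMinimalPoint T x}

/-- `τ_d = T × T² × ⋯ × T^d` on `X^d`; the coordinates are numbered `0, …, d - 1`, and `T ^ (i + 1)`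
acts on coordinate `i`. -/
def tauPow {X : Type*} [TopologicalSpace X] (T : X ≃ₜ X) (d : ℕ) : (Fin d → X) ≃ₜ (Fin d → X) :=
  Homeomorph.piCongrRight fun i : Fin d => T ^ ((i : ℕ) + 1)

/-- A topological dynamical system: a compact metric space with a self-homeomorphism. -/
structure TDS : Type (u + 1) where
  carrier : Type u
  [metric : MetricSpace carrier]
  [compact : CompactSpace carrier]
  T : carrier ≃ₜ carrier

namespace TDS

instance : CoeSort TDS.{u} (Type u) := ⟨TDS.carrier⟩

attribute [instance] TDS.metric TDS.compact

/-- The (nonempty) system is minimal: every orbit is dense. -/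
def IsMinimal (X : TDS.{u}) : Prop :=
  Nonempty X ∧ ∀ x : X, Dense (zOrbit X.T x)

/-- A proximal pair: `liminf_{n → ∞} ρ(Tⁿ x, Tⁿ y) = 0`. -/
def IsProximalPair (X : TDS.{u}) (x y : X) : Prop :=
  liminf (fun n : ℕ => dist ((X.T ^ n) x) ((X.T ^ n) y)) atTop = 0

/-- An extension (factor map) `π : (X, T) → (Y, S)`. -/
structure IsExtension (X Y : TDS.{u}) (π : X → Y) : Prop where
  continuous : Continuous π
  surjective : Function.Surjective π
  equivariant : ∀ x, π (X.T x) = Y.T (π x)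

/-- A proximal extension: any two points of a fibre form a proximal pair. -/
structure IsProximalExtension (X Y : TDS.{u}) (π : X → Y) : Prop
    extends IsExtension X Y π where
  proximal : ∀ x₁ x₂ : X, π x₁ = π x₂ → X.IsProximalPair x₁ x₂

/-- An equicontinuous (isometric) extension. -/
structure IsEquicontinuousExtension (X Y : TDS.{u}) (π : X → Y) : Prop
    extends IsExtension X Y π where
  equicontinuous : ∀ ε > 0, ∃ δ > 0, ∀ x₁ x₂ : X, π x₁ = π x₂ → dist x₁ x₂ < δ →
    ∀ n : ℤ, dist ((X.T ^ n) x₁) ((X.T ^ n) x₂) < ε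

/-- A tower of pointed systems `(W ι, pt ι)`, `ι ≤ η`, which starts with the trivial system, has
proximal or equicontinuous extensions at the successor steps and inverse limits at the limit steps.
`proj ι κ : W κ → W ι`, for `ι ≤ κ`, are the bonding maps. All data at indices beyond `η`, and
`proj ι κ` for `κ < ι`, are irrelevant. -/
structure IsPITower (η : Ordinal.{u}) (W : Ordinal.{u} → TDS.{u}) (pt : ∀ ι, W ι)
    (proj : ∀ ι κ, W κ → W ι) : Prop where
  isExtension : ∀ ι κ, ι ≤ κ → κ ≤ η → IsExtension (W κ) (W ι) (proj ι κ)
  proj_pt : ∀ ι κ, ι ≤ κ → κ ≤ η → proj ι κ (pt κ) = pt ι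
  proj_self : ∀ ι, ι ≤ η → ∀ w, proj ι ι w = w
  proj_proj : ∀ ι κ μ, ι ≤ κ → κ ≤ μ → μ ≤ η → ∀ w, proj ι κ (proj κ μ w) = proj ι μ w
  trivial_zero : Subsingleton (W 0)
  succ_step : ∀ ι, ι < η →
    IsProximalExtension (W (Order.succ ι)) (W ι) (proj ι (Order.succ ι)) ∨
    IsEquicontinuousExtension (W (Order.succ ι)) (W ι) (proj ι (Order.succ ι))
  /-- `W ν` is the inverse limit of the `W ι`, `ι < ν`: the canonical (continuous) map from the
  compact space `W ν` to the space of compatible families is a bijection. -/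
  limit_step : ∀ ν, ν ≤ η → Order.IsSuccLimit ν →
    ∀ x : (∀ ι : Set.Iio ν, W ι),
      (∀ ι κ : Set.Iio ν, ι ≤ κ → proj ι κ (x κ) = x ι) →
      ∃! w : W ν, ∀ ι : Set.Iio ν, proj ι ν w = x ι

/-- A strictly PI system: a minimal system isomorphic to the top of such a tower. -/
def IsStrictlyPI (X : TDS.{u}) : Prop :=
  X.IsMinimal ∧ ∃ (η : Ordinal.{u}) (W : Ordinal.{u} → TDS.{u}) (pt : ∀ ι, W ι)
    (proj : ∀ ι κ, W κ → W ι), IsPITower η W pt proj ∧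
    ∃ e : W η ≃ₜ X, ∀ w, e ((W η).T w) = X.T (e w)

/-- A PI system: some strictly PI system is a proximal extension of it. -/
def IsPI (X : TDS.{u}) : Prop :=
  ∃ (X' : TDS.{u}) (θ : X' → X), X'.IsStrictlyPI ∧ IsProximalExtension X' X θ

end TDS

/-!
Say that a homeomorphism `S` of a compact space has property (M) if every M-subsystem of `S` is
minimal. The theorem is property (M) for `τ_d` on `X ^ d`, and it follows by transporting (M) along
the tower which defines a PI system, that is, by proving (M) for `τ_d` on `(W ι) ^ d` by induction
on `ι`. In each of the following cases let `Z` be an M-subsystem of the extension; its image in the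
base is an M-subsystem, hence minimal.

* Proximal extensions (`MSubsystemsMinimal.of_proximal`). Two minimal sets of `Z` have points over a
  common point of the base. A minimal point in the orbit closure of such a pair has, in each
  coordinate, a pair which is minimal and proximal, hence diagonal. So the two minimal sets meet and
  `Z` has only one minimal set, in which its dense set of minimal points is contained.
* Equicontinuous extensions are distal (`MSubsystemsMinimal.of_distal`). A point of a distal extension
  lying over a minimal point is minimal, by an idempotent of the Ellis semigroup
  (`isMinimalPoint_of_distal`). Since `Z` is metrizable and transitive it is the orbit closure of one
  of its points (`IsTransitiveOn.exists_dense_orbit`), and this point is minimal.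
* Inverse limits (`MSubsystemsMinimal.of_limit`). A minimal subset of `Z` has the same image as `Z` at
  every stage, so it equals `Z` by compactness.

Finally (M) passes to factors (`MSubsystemsMinimal.of_factor`): among the subsystems which map onto
an M-subsystem `Z` of the factor there is an inclusion-minimal one, and it is again an M-subsystem:
every lift of a transitive point of `Z` has dense orbit in it, and its minimal points are dense in it
because their closure still maps onto `Z`. The passage from `T` to its powers costs nothing:
equicontinuity is inherited, and a `T`-proximal pair is `T ^ k`-proximal by uniform continuity of
`T, …, T ^ k`.
-/

/-! ### Subsystems and orbit closures -/

section Dynamics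

variable {K L : Type*} [TopologicalSpace K] [TopologicalSpace L] {S : K ≃ₜ K} {R : L ≃ₜ L}
  {Z M : Set K} {π : K → L}

lemma zpow_apply_of_semiconj (hπ : ∀ x, π (S x) = R (π x)) (n : ℤ) (x : K) :
    π ((S ^ n) x) = (R ^ n) (π x) := by
  induction n using Int.induction_on generalizing x with
  | zero => rfl
  | succ n ih =>
    rw [zpow_add_one, zpow_add_one]
    change π ((S ^ (n : ℤ)) (S x)) = (R ^ (n : ℤ)) (R (π x))
    rw [ih, hπ]
  | pred n ih =>
    rw [zpow_sub_one, zpow_sub_one]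
    change π ((S ^ (-n : ℤ)) (S.symm x)) = (R ^ (-n : ℤ)) (R.symm (π x))
    rw [ih]
    congr 1
    rw [Homeomorph.eq_symm_apply, ← hπ, Homeomorph.apply_symm_apply]

lemma self_mem_zOrbit (x : K) : x ∈ zOrbit S x := ⟨0, rfl⟩

lemma IsSubsystem.apply_mem_iff (hZ : IsSubsystem S Z) (x : K) : S x ∈ Z ↔ x ∈ Z := by
  constructor
  · intro h
    rw [← hZ.image_eq] at h
    obtain ⟨y, hy, hyx⟩ := h
    rwa [← S.injective hyx]
  · intro h
    rw [← hZ.image_eq]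
    exact ⟨x, h, rfl⟩

lemma isSubsystem_of_apply_mem_iff (hne : Z.Nonempty) (hc : IsClosed Z)
    (h : ∀ x, S x ∈ Z ↔ x ∈ Z) : IsSubsystem S Z := by
  refine ⟨hne, hc, Set.ext fun y => ⟨?_, fun hy => ?_⟩⟩
  · rintro ⟨x, hx, rfl⟩
    exact (h x).2 hx
  · refine ⟨S.symm y, ?_, S.apply_symm_apply y⟩
    rwa [← h, S.apply_symm_apply]

lemma IsSubsystem.zpow_mem (hZ : IsSubsystem S Z) (n : ℤ) {x : K} (hx : x ∈ Z) :
    (S ^ n) x ∈ Z := by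
  induction n using Int.induction_on generalizing x with
  | zero => exact hx
  | succ n ih =>
    rw [zpow_add_one]
    exact ih ((hZ.apply_mem_iff x).2 hx)
  | pred n ih =>
    rw [zpow_sub_one]
    refine ih (x := S.symm x) ?_
    rwa [← hZ.apply_mem_iff, S.apply_symm_apply]

lemma IsSubsystem.closure_zOrbit_subset (hZ : IsSubsystem S Z) {x : K} (hx : x ∈ Z) :
    closure (zOrbit S x) ⊆ Z := by
  refine closure_minimal ?_ hZ.isClosed
  rintro _ ⟨n, rfl⟩
  exact hZ.zpow_mem n hx

lemma isSubsystem_closure_zOrbit (S : K ≃ₜ K) (x : K) :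
    IsSubsystem S (closure (zOrbit S x)) := by
  refine ⟨⟨x, subset_closure (self_mem_zOrbit x)⟩, isClosed_closure, ?_⟩
  rw [S.image_closure]
  congr 1
  ext y
  constructor
  · rintro ⟨_, ⟨n, rfl⟩, rfl⟩
    exact ⟨1 + n, by rw [zpow_add, zpow_one]; rfl⟩
  · rintro ⟨n, rfl⟩
    refine ⟨(S ^ (n - 1)) x, ⟨_, rfl⟩, ?_⟩
    conv_rhs => rw [show n = 1 + (n - 1) by ring, zpow_add, zpow_one]
    rfl

/-- A subsystem is minimal exactly when it contains no smaller subsystem; this is the direction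
used for constructing minimal subsystems. -/
lemma IsSubsystem.isMinimalSubsystem (hZ : IsSubsystem S Z)
    (h : ∀ N ⊆ Z, IsSubsystem S N → N = Z) : IsMinimalSubsystem S Z :=
  ⟨hZ, fun x hx =>
    (h _ (hZ.closure_zOrbit_subset hx) (isSubsystem_closure_zOrbit S x)).symm.subset⟩

lemma IsMinimalSubsystem.eq_of_subset (hM : IsMinimalSubsystem S M) (hZ : IsSubsystem S Z)
    (h : Z ⊆ M) : Z = M := by
  obtain ⟨x, hx⟩ := hZ.nonempty
  exact h.antisymm ((hM.dense_orbit x (h hx)).trans (hZ.closure_zOrbit_subset hx))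

lemma IsMinimalSubsystem.closure_zOrbit_eq (hM : IsMinimalSubsystem S M) {x : K} (hx : x ∈ M) :
    closure (zOrbit S x) = M :=
  hM.eq_of_subset (isSubsystem_closure_zOrbit S x) (hM.closure_zOrbit_subset hx)

lemma IsMinimalSubsystem.isMinimalPoint (hM : IsMinimalSubsystem S M) {x : K} (hx : x ∈ M) :
    IsMinimalPoint S x := by
  rw [IsMinimalPoint, hM.closure_zOrbit_eq hx]
  exact hM

lemma isTransitiveOn_of_dense_orbit {x : K} (hx : x ∈ Z) (hZ : IsSubsystem S Z)
    (h : Z ⊆ closure (zOrbit S x)) : IsTransitiveOn S Z := by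
  rintro U V hU hV ⟨a, haU, haZ⟩ ⟨b, hbV, hbZ⟩
  obtain ⟨_, hpU, p, rfl⟩ := mem_closure_iff.1 (h haZ) U hU haU
  obtain ⟨_, hqV, q, rfl⟩ := mem_closure_iff.1 (h hbZ) V hV hbV
  refine ⟨q - p, (S ^ p) x, ⟨hpU, hZ.zpow_mem p hx⟩, ?_⟩
  have : (S ^ (q - p)) ((S ^ p) x) = (S ^ q) x := by
    conv_rhs => rw [← sub_add_cancel q p, zpow_add]
    rfl
  rw [this]
  exact ⟨hqV, hZ.zpow_mem q hx⟩

/-- A transitive subsystem of a compact metrizable system is the orbit closure of one of its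
points, by the Baire category theorem. -/
lemma IsTransitiveOn.exists_dense_orbit [CompactSpace K] [T2Space K]
    [SecondCountableTopology K] (hZ : IsSubsystem S Z) (h : IsTransitiveOn S Z) :
    ∃ x ∈ Z, Z ⊆ closure (zOrbit S x) := by
  have : CompactSpace Z := isCompact_iff_compactSpace.1 hZ.isClosed.isCompact
  have : Nonempty Z := hZ.nonempty.to_subtype
  let B := {U : Set K // U ∈ TopologicalSpace.countableBasis K ∧ (U ∩ Z).Nonempty}
  have : Countable B :=
    ((TopologicalSpace.countable_countableBasis K).mono fun U hU => hU.1).to_subtype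
  have hopen : ∀ U : B, IsOpen U.1 := fun U => TopologicalSpace.isOpen_of_mem_countableBasis U.2.1
  let G : B → Set Z := fun U => {x | ∃ n : ℤ, (S ^ n) (x : K) ∈ U.1}
  have hG : Dense (⋂ U, G U) := by
    refine dense_iInter_of_isOpen (fun U => ?_) (fun U => ?_)
    · have : G U = ⋃ n : ℤ, (fun x : Z => (S ^ n) (x : K)) ⁻¹' U.1 := by
        ext x
        simp [G]
      rw [this]
      exact isOpen_iUnion fun n =>
        (hopen U).preimage ((S ^ n).continuous.comp continuous_subtype_val)
    · rw [dense_iff_inter_open]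
      rintro V hV ⟨v, hv⟩
      obtain ⟨V', hV', rfl⟩ := isOpen_induced_iff.1 hV
      obtain ⟨n, x, hx, hxU⟩ := h V' U.1 hV' (hopen U) ⟨v, hv, v.2⟩ U.2.2
      exact ⟨⟨x, hx.2⟩, hx.1, n, hxU.1⟩
  obtain ⟨x, hx⟩ := hG.nonempty
  refine ⟨x, x.2, fun z hz => ?_⟩
  rw [(TopologicalSpace.isBasis_countableBasis K).mem_closure_iff]
  intro U hU hzU
  obtain ⟨n, hn⟩ := Set.mem_iInter.1 hx ⟨U, hU, z, hzU, hz⟩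
  exact ⟨_, hn, n, rfl⟩

/-! ### Factor maps -/

lemma image_closure_zOrbit_subset (hc : Continuous π) (hπ : ∀ x, π (S x) = R (π x)) (x : K) :
    π '' closure (zOrbit S x) ⊆ closure (zOrbit R (π x)) := by
  refine (image_closure_subset_closure_image hc).trans (closure_mono ?_)
  rintro _ ⟨_, ⟨n, rfl⟩, rfl⟩
  exact ⟨n, (zpow_apply_of_semiconj hπ n x).symm⟩

section Image

variable [CompactSpace K] [T2Space L]

lemma IsSubsystem.image (hZ : IsSubsystem S Z) (hc : Continuous π)
    (hπ : ∀ x, π (S x) = R (π x)) : IsSubsystem R (π '' Z) := by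
  refine ⟨hZ.nonempty.image _, (hZ.isClosed.isCompact.image hc).isClosed, ?_⟩
  conv_rhs => rw [← hZ.image_eq]
  simp only [Set.image_image, hπ]

lemma IsMinimalSubsystem.image (hM : IsMinimalSubsystem S M) (hc : Continuous π)
    (hπ : ∀ x, π (S x) = R (π x)) : IsMinimalSubsystem R (π '' M) := by
  refine ⟨hM.toIsSubsystem.image hc hπ, ?_⟩
  rintro _ ⟨x, hx, rfl⟩
  exact (Set.image_mono (hM.dense_orbit x hx)).trans (image_closure_zOrbit_subset hc hπ x)

lemma IsMinimalPoint.map {x : K} (hx : IsMinimalPoint S x) (hc : Continuous π)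
    (hπ : ∀ x, π (S x) = R (π x)) : IsMinimalPoint R (π x) :=
  (IsMinimalSubsystem.image hx hc hπ).isMinimalPoint
    ⟨x, subset_closure (self_mem_zOrbit x), rfl⟩

lemma IsMSubsystem.image (hZ : IsMSubsystem S Z) (hc : Continuous π)
    (hπ : ∀ x, π (S x) = R (π x)) : IsMSubsystem R (π '' Z) := by
  refine ⟨hZ.toIsSubsystem.image hc hπ, ?_, ?_⟩
  · rintro U V hU hV ⟨_, hxU, x, hx, rfl⟩ ⟨_, hyV, y, hy, rfl⟩
    obtain ⟨n, z, hzU, hzV⟩ := hZ.transitive _ _ (hU.preimage hc) (hV.preimage hc)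
      ⟨x, hxU, hx⟩ ⟨y, hyV, hy⟩
    refine ⟨n, π z, ⟨hzU.1, z, hzU.2, rfl⟩, ?_⟩
    rw [← zpow_apply_of_semiconj hπ]
    exact ⟨hzV.1, _, hzV.2, rfl⟩
  · refine (Set.image_mono hZ.dense_minimal).trans
      ((image_closure_subset_closure_image hc).trans (closure_mono ?_))
    rintro _ ⟨x, hx, rfl⟩
    exact ⟨⟨x, hx.1, rfl⟩, hx.2.map hc hπ⟩

/-- Among the subsystems of `Z` with the same image as `Z` there is a minimal one, by Zorn's
lemma: compactness of the fibres shows that the image of the intersection of a chain is still the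
image of `Z`. -/
lemma IsSubsystem.exists_minimal_image_eq (hZ : IsSubsystem S Z) (hc : Continuous π) :
    ∃ M ⊆ Z, IsSubsystem S M ∧ π '' M = π '' Z ∧
      ∀ N ⊆ M, IsSubsystem S N → π '' N = π '' Z → N = M := by
  suffices hchains : ∀ c ⊆ {M | IsSubsystem S M ∧ π '' M = π '' Z}, IsChain (· ⊆ ·) c →
      c.Nonempty → ∃ lb ∈ {M | IsSubsystem S M ∧ π '' M = π '' Z}, ∀ s ∈ c, lb ⊆ s by
    obtain ⟨M, hMZ, hM⟩ := zorn_superset_nonempty _ hchains Z ⟨hZ, rfl⟩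
    exact ⟨M, hMZ, hM.prop.1, hM.prop.2, fun N hN h1 h2 => hM.eq_of_subset ⟨h1, h2⟩ hN⟩
  intro c hcS hchain hne
  have himage : π '' ⋂₀ c = π '' Z := by
    obtain ⟨N₀, hN₀⟩ := hne
    refine Set.Subset.antisymm ?_ ?_
    · rw [← (hcS hN₀).2]
      exact Set.image_mono (Set.sInter_subset_of_mem hN₀)
    · intro y hy
      have : Nonempty c := ⟨⟨N₀, hN₀⟩⟩
      have hcl : ∀ N : c, IsClosed (N.1 ∩ π ⁻¹' {y}) := fun N =>
        (hcS N.2).1.isClosed.inter (isClosed_singleton.preimage hc)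
      obtain ⟨x, hx⟩ := IsCompact.nonempty_iInter_of_directed_nonempty_isCompact_isClosed
        (fun N : c => N.1 ∩ π ⁻¹' {y})
        (fun N N' => by
          rcases hchain.total N.2 N'.2 with h | h
          · exact ⟨N, subset_rfl, Set.inter_subset_inter_left _ h⟩
          · exact ⟨N', Set.inter_subset_inter_left _ h, subset_rfl⟩)
        (fun N => by
          rw [← (hcS N.2).2] at hy
          obtain ⟨x, hx, hxy⟩ := hy
          exact ⟨x, hx, hxy⟩)
        (fun N => (hcl N).isCompact) hcl
      rw [Set.mem_iInter] at hx
      exact ⟨x, fun N hN => (hx ⟨N, hN⟩).1, (hx ⟨N₀, hN₀⟩).2⟩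
  refine ⟨⋂₀ c, ⟨isSubsystem_of_apply_mem_iff ?_ ?_ ?_, himage⟩,
    fun N hN => Set.sInter_subset_of_mem hN⟩
  · rw [← Set.image_nonempty (f := π), himage]
    exact hZ.nonempty.image π
  · exact isClosed_sInter fun N hN => (hcS hN).1.isClosed
  · intro x
    exact forall₂_congr fun N hN => (hcS hN).1.apply_mem_iff x

end Image

lemma IsSubsystem.exists_isMinimalSubsystem [CompactSpace K] (hZ : IsSubsystem S Z) :
    ∃ M ⊆ Z, IsMinimalSubsystem S M := by
  have hunit : ∀ {N : Set K}, N.Nonempty → (fun _ : K => ()) '' N = Set.univ := fun h =>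
    Set.eq_univ_of_forall fun _ => h.imp fun _ hx => ⟨hx, rfl⟩
  obtain ⟨M, hMZ, hM, -, hmin⟩ :=
    hZ.exists_minimal_image_eq (π := fun _ : K => ()) continuous_const
  refine ⟨M, hMZ, hM.isMinimalSubsystem fun N hN hNs => hmin N hN hNs ?_⟩
  rw [hunit hNs.nonempty, hunit hZ.nonempty]

/-- Minimal subsystems of the image of `Z` lift to minimal subsystems of `Z`. -/
lemma IsSubsystem.exists_isMinimalSubsystem_image_eq [CompactSpace K] [T2Space L]
    (hZ : IsSubsystem S Z) (hc : Continuous π) (hπ : ∀ x, π (S x) = R (π x)) {N : Set L}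
    (hN : IsMinimalSubsystem R N) (hNZ : N ⊆ π '' Z) :
    ∃ M ⊆ Z, IsMinimalSubsystem S M ∧ π '' M = N := by
  have hsub : IsSubsystem S (Z ∩ π ⁻¹' N) := by
    refine isSubsystem_of_apply_mem_iff ?_ (hZ.isClosed.inter (hN.isClosed.preimage hc)) ?_
    · obtain ⟨y, hy⟩ := hN.nonempty
      obtain ⟨x, hx, rfl⟩ := hNZ hy
      exact ⟨x, hx, hy⟩
    · intro x
      rw [Set.mem_inter_iff, Set.mem_inter_iff, hZ.apply_mem_iff, Set.mem_preimage, hπ,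
        hN.toIsSubsystem.apply_mem_iff, Set.mem_preimage]
  obtain ⟨M, hM, hMmin⟩ := hsub.exists_isMinimalSubsystem
  refine ⟨M, hM.trans Set.inter_subset_left, hMmin,
    hN.eq_of_subset (hMmin.toIsSubsystem.image hc hπ) ?_⟩
  rintro _ ⟨x, hx, rfl⟩
  exact (hM hx).2

/-! ### Distal lifts of minimal points -/

/-- The pointwise closure of the powers of `S` (its Ellis semigroup) is closed under composition. -/
lemma comp_mem_closure_range_zpow {f g : K → K}
    (hf : f ∈ closure (Set.range fun n : ℤ => ⇑(S ^ n)))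
    (hg : g ∈ closure (Set.range fun n : ℤ => ⇑(S ^ n))) :
    f ∘ g ∈ closure (Set.range fun n : ℤ => ⇑(S ^ n)) := by
  have hleft : ∀ n : ℤ, ⇑(S ^ n) ∘ g ∈ closure (Set.range fun n : ℤ => ⇑(S ^ n)) := by
    intro n
    have hcont : Continuous fun h : K → K => ⇑(S ^ n) ∘ h :=
      continuous_pi fun x => (S ^ n).continuous.comp (continuous_apply x)
    refine map_mem_closure hcont hg ?_
    rintro _ ⟨m, rfl⟩
    exact ⟨n + m, by simp only [zpow_add]; rfl⟩
  have hcont : Continuous fun h : K → K => h ∘ g :=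
    continuous_pi fun x => continuous_apply (g x)
  have := map_mem_closure hcont hf (t := closure (Set.range fun n : ℤ => ⇑(S ^ n))) (by
    rintro _ ⟨n, rfl⟩
    exact hleft n)
  rwa [closure_closure] at this

/-- A point `z` over a minimal point is minimal if every `z'` in its fibre which is proximal to
`z` equals `z`; the hypothesis `hdist` says this with "proximal" expressed by the
orbit closure of `(z, z')` meeting the diagonal. An idempotent `u` of the Ellis semigroup with
`u z` in a minimal set and `π (u z) = π z` makes `z` and `u z` proximal. -/
lemma isMinimalPoint_of_distal [CompactSpace K] [T2Space K] [T2Space L] (hc : Continuous π)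
    (hπ : ∀ x, π (S x) = R (π x))
    (hdist : ∀ a b c, π a = π b → (c, c) ∈ closure (zOrbit (S.prodCongr S) (a, b)) → a = b)
    {z : K} (hz : IsMinimalPoint R (π z)) : IsMinimalPoint S z := by
  set E : Set (K → K) := closure (Set.range fun n : ℤ => ⇑(S ^ n)) with hE
  have hEc : IsCompact E := isClosed_closure.isCompact
  obtain ⟨M, hMz, hM⟩ := (isSubsystem_closure_zOrbit S z).exists_isMinimalSubsystem
  have hEz : ∀ w ∈ closure (zOrbit S z), ∃ f ∈ E, f z = w := by
    have : closure (zOrbit S z) ⊆ (fun f : K → K => f z) '' E := by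
      refine closure_minimal ?_ (hEc.image (continuous_apply z)).isClosed
      rintro _ ⟨n, rfl⟩
      exact ⟨_, subset_closure ⟨n, rfl⟩, rfl⟩
    exact this
  have hEmem : ∀ f ∈ E, ∀ {N : Set K}, IsSubsystem S N → ∀ x ∈ N, f x ∈ N := by
    intro f hf N hN x hx
    have : f x ∈ closure N := map_mem_closure (f := fun h : K → K => h x) (continuous_apply x) hf (by
      rintro _ ⟨n, rfl⟩
      exact hN.zpow_mem n hx)
    rwa [hN.isClosed.closure_eq] at this
  have hEπ : ∀ f ∈ E, ∀ x y, π x = π y → π (f x) = π (f y) := by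
    intro f hf x y hxy
    have hclosed : IsClosed {f : K → K | π (f x) = π (f y)} :=
      isClosed_eq (hc.comp (continuous_apply x)) (hc.comp (continuous_apply y))
    refine closure_minimal ?_ hclosed hf
    rintro _ ⟨n, rfl⟩
    simp only [Set.mem_ofPred_eq, zpow_apply_of_semiconj hπ, hxy]
  -- the compact semigroup of those `f` which move `z` into `M` within the fibre of `z`
  let s : Set (K → K) := E ∩ {f | f z ∈ M ∧ π (f z) = π z}
  have hs_closed : IsClosed s := by
    refine isClosed_closure.inter (IsClosed.inter ?_ ?_)
    · exact hM.isClosed.preimage (continuous_apply z)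
    · exact isClosed_eq (hc.comp (continuous_apply z)) continuous_const
  have hs_ne : s.Nonempty := by
    have hsub : π '' M ⊆ closure (zOrbit R (π z)) :=
      (Set.image_mono hMz).trans (image_closure_zOrbit_subset hc hπ z)
    have heq : π '' M = closure (zOrbit R (π z)) :=
      IsMinimalSubsystem.eq_of_subset hz (hM.toIsSubsystem.image hc hπ) hsub
    obtain ⟨m, hm, hmz⟩ : π z ∈ π '' M := by
      rw [heq]
      exact subset_closure (self_mem_zOrbit _)
    obtain ⟨f, hf, rfl⟩ := hEz m (hMz hm)
    exact ⟨f, hf, hm, hmz⟩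
  let _ : Semigroup (K → K) := { mul := fun f g => f ∘ g, mul_assoc := fun _ _ _ => rfl }
  obtain ⟨u, ⟨huE, huM, huz⟩, huu⟩ := exists_idempotent_in_compact_subsemigroup
    (fun g : K → K => continuous_pi fun x => continuous_apply (g x)) s hs_ne hs_closed.isCompact
    (by
      rintro f ⟨hf, hfM, hfz⟩ g ⟨hg, hgM, hgz⟩
      exact ⟨comp_mem_closure_range_zpow hf hg, hEmem f hf hM.toIsSubsystem _ hgM,
        (hEπ f hf (g z) z hgz).trans hfz⟩)
  have huu' : u (u z) = u z := congrFun huu z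
  have hprox : (u z, u (u z)) ∈ closure (zOrbit (S.prodCongr S) (z, u z)) := by
    have hcont : Continuous fun f : K → K => (f z, f (u z)) :=
      (continuous_apply z).prodMk (continuous_apply (u z))
    refine map_mem_closure (f := fun f : K → K => (f z, f (u z))) hcont huE ?_
    rintro _ ⟨n, rfl⟩
    refine ⟨n, Prod.ext ?_ ?_⟩
    · exact zpow_apply_of_semiconj (S := S.prodCongr S) (R := S) (π := Prod.fst) (fun _ => rfl) n _
    · exact zpow_apply_of_semiconj (S := S.prodCongr S) (R := S) (π := Prod.snd) (fun _ => rfl) n _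
  rw [huu'] at hprox
  rw [hdist z (u z) (u z) huz.symm hprox]
  exact hM.isMinimalPoint huM

end Dynamics

/-! ### Systems whose M-subsystems are minimal -/

/-- Every M-subsystem of `(K, S)` is minimal. -/
def MSubsystemsMinimal {K : Type*} [TopologicalSpace K] (S : K ≃ₜ K) : Prop :=
  ∀ Z : Set K, IsMSubsystem S Z → IsMinimalSubsystem S Z

namespace MSubsystemsMinimal

lemma of_subsingleton {K : Type*} [TopologicalSpace K] [Subsingleton K] {S : K ≃ₜ K} :
    MSubsystemsMinimal S := fun _ hZ =>
  ⟨hZ.toIsSubsystem, fun x _ y _ => by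
    rw [Subsingleton.elim y x]
    exact subset_closure (self_mem_zOrbit x)⟩

variable {K L : Type*} [TopologicalSpace K] [TopologicalSpace L] [CompactSpace K]
  [T2Space L] {S : K ≃ₜ K} {R : L ≃ₜ L} {π : K → L}

lemma of_factor [SecondCountableTopology L] (hK : MSubsystemsMinimal S) (hc : Continuous π)
    (hs : Function.Surjective π) (hπ : ∀ x, π (S x) = R (π x)) : MSubsystemsMinimal R := by
  have : CompactSpace L := hs.compactSpace hc
  intro Z hZ
  have hpre : IsSubsystem S (π ⁻¹' Z) := by
    refine isSubsystem_of_apply_mem_iff (hZ.nonempty.preimage hs) (hZ.isClosed.preimage hc) ?_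
    intro x
    rw [Set.mem_preimage, hπ, hZ.toIsSubsystem.apply_mem_iff, Set.mem_preimage]
  obtain ⟨Y, -, hY, hYZ, hYmin⟩ := hpre.exists_minimal_image_eq hc
  rw [Set.image_preimage_eq _ hs] at hYZ hYmin
  rw [← hYZ]
  refine IsMinimalSubsystem.image (hK Y ⟨hY, ?_, ?_⟩) hc hπ
  · -- a lift of a transitive point of `Z` has dense orbit in `Y`, by the choice of `Y`
    obtain ⟨z, hz, hzZ⟩ := hZ.transitive.exists_dense_orbit hZ.toIsSubsystem
    rw [← hYZ] at hz
    obtain ⟨y, hy, rfl⟩ := hz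
    refine isTransitiveOn_of_dense_orbit hy hY (hYmin _ (hY.closure_zOrbit_subset hy)
      (isSubsystem_closure_zOrbit S y) ?_).symm.subset
    refine Set.Subset.antisymm ?_ (hzZ.trans ?_)
    · rw [← hYZ]
      exact Set.image_mono (hY.closure_zOrbit_subset hy)
    · refine IsSubsystem.closure_zOrbit_subset
        ((isSubsystem_closure_zOrbit S y).image hc hπ) ⟨y, ?_, rfl⟩
      exact subset_closure (self_mem_zOrbit y)
  · -- the closure of the minimal points of `Y` is a subsystem which maps onto `Z`
    set D : Set K := {x | x ∈ Y ∧ IsMinimalPoint S x}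
    have hDY : closure D ⊆ Y := closure_minimal (fun x hx => hx.1) hY.isClosed
    have hZD : Z ⊆ π '' closure D := by
      have hcl : IsClosed (π '' closure D) := (isClosed_closure.isCompact.image hc).isClosed
      refine hZ.dense_minimal.trans (closure_minimal ?_ hcl)
      rintro z ⟨hz, hzmin⟩
      have hzY : closure (zOrbit R z) ⊆ π '' Y := by
        rw [hYZ]
        exact hZ.toIsSubsystem.closure_zOrbit_subset hz
      obtain ⟨M, hMY, hM, hMz⟩ := hY.exists_isMinimalSubsystem_image_eq hc hπ hzmin hzY
      have hzM : z ∈ π '' M := by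
        rw [hMz]
        exact subset_closure (self_mem_zOrbit z)
      obtain ⟨m, hm, rfl⟩ := hzM
      exact ⟨m, subset_closure ⟨hMY hm, hM.isMinimalPoint hm⟩, rfl⟩
    have hDsub : IsSubsystem S (closure D) := by
      refine ⟨?_, isClosed_closure, ?_⟩
      · exact (hZ.nonempty.mono hZD).of_image
      · rw [S.image_closure]
        congr 1
        ext x
        have key : ∀ y, S y ∈ D ↔ y ∈ D := by
          intro y
          refine and_congr (hY.apply_mem_iff y) ?_
          have hmem : S y ∈ closure (zOrbit S y) :=
            ((isSubsystem_closure_zOrbit S y).apply_mem_iff y).2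
              (subset_closure (self_mem_zOrbit y))
          have hmem' : y ∈ closure (zOrbit S (S y)) :=
            ((isSubsystem_closure_zOrbit S (S y)).apply_mem_iff y).1
              (subset_closure (self_mem_zOrbit (S y)))
          exact ⟨fun h => IsMinimalSubsystem.isMinimalPoint h hmem',
            fun h => IsMinimalSubsystem.isMinimalPoint h hmem⟩
        rw [← S.apply_symm_apply x, key, S.injective.mem_set_image]
    refine (hYmin _ hDY hDsub (Set.Subset.antisymm ?_ hZD)).symm.subset
    rw [← hYZ]
    exact Set.image_mono hDY

/-- Proximality of `π` enters as the statement that a minimal pair of points of one fibre is a pair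
of equal points. -/
lemma of_proximal (hL : MSubsystemsMinimal R) (hc : Continuous π) (hπ : ∀ x, π (S x) = R (π x))
    (hprox : ∀ a b, π a = π b → IsMinimalPoint (S.prodCongr S) (a, b) → a = b) :
    MSubsystemsMinimal S := by
  intro Z hZ
  have hπZ := hL _ (hZ.image hc hπ)
  obtain ⟨M, hMZ, hM⟩ := hZ.toIsSubsystem.exists_isMinimalSubsystem
  have hMπ : π '' M = π '' Z :=
    hπZ.eq_of_subset (hM.toIsSubsystem.image hc hπ) (Set.image_mono hMZ)
  have hmem : ∀ x ∈ Z, IsMinimalPoint S x → x ∈ M := by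
    intro x hx hxmin
    obtain ⟨m, hm, hmx⟩ : π x ∈ π '' M := by
      rw [hMπ]
      exact ⟨x, hx, rfl⟩
    obtain ⟨N, hN, hNmin⟩ :=
      (isSubsystem_closure_zOrbit (S.prodCongr S) (m, x)).exists_isMinimalSubsystem
    obtain ⟨⟨a, b⟩, hab⟩ := hNmin.nonempty
    have ha : a ∈ closure (zOrbit S m) := image_closure_zOrbit_subset (S := S.prodCongr S) (R := S)
      continuous_fst (fun _ => rfl) (m, x) ⟨_, hN hab, rfl⟩
    have hb : b ∈ closure (zOrbit S x) := image_closure_zOrbit_subset (S := S.prodCongr S) (R := S)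
      continuous_snd (fun _ => rfl) (m, x) ⟨_, hN hab, rfl⟩
    have hfib : π a = π b := by
      have hclosed : IsClosed {p : K × K | π p.1 = π p.2} :=
        isClosed_eq (hc.comp continuous_fst) (hc.comp continuous_snd)
      refine (IsSubsystem.closure_zOrbit_subset (Z := {p : K × K | π p.1 = π p.2})
        (isSubsystem_of_apply_mem_iff ⟨(m, x), hmx⟩ hclosed ?_) hmx) (hN hab)
      rintro ⟨p, q⟩
      change π (S p) = π (S q) ↔ π p = π q
      rw [hπ, hπ, R.injective.eq_iff]
    obtain rfl := hprox a b hfib (hNmin.isMinimalPoint hab)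
    have hxa : x ∈ closure (zOrbit S a) := by
      rw [IsMinimalSubsystem.closure_zOrbit_eq hxmin hb]
      exact subset_closure (self_mem_zOrbit x)
    exact hM.toIsSubsystem.closure_zOrbit_subset (hM.toIsSubsystem.closure_zOrbit_subset hm ha) hxa
  have hZM : Z ⊆ M := hZ.dense_minimal.trans
    (closure_minimal (fun x hx => hmem x hx.1 hx.2) hM.isClosed)
  rwa [hZM.antisymm hMZ]

/-- Distality of `π` enters as the statement that two distinct points of one fibre are not
proximal, that is, the orbit closure of the pair does not meet the diagonal. -/
lemma of_distal [T2Space K] [SecondCountableTopology K] (hL : MSubsystemsMinimal R) (hc : Continuous π)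
    (hπ : ∀ x, π (S x) = R (π x))
    (hdist : ∀ a b c, π a = π b → (c, c) ∈ closure (zOrbit (S.prodCongr S) (a, b)) → a = b) :
    MSubsystemsMinimal S := by
  intro Z hZ
  obtain ⟨z, hz, hzZ⟩ := hZ.transitive.exists_dense_orbit hZ.toIsSubsystem
  rw [hzZ.antisymm (hZ.toIsSubsystem.closure_zOrbit_subset hz)]
  exact isMinimalPoint_of_distal hc hπ hdist ((hL _ (hZ.image hc hπ)).isMinimalPoint ⟨z, hz, rfl⟩)

/-- Passage to an inverse limit. Of the universal property only this is needed: the maps `π i`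
separate points, and their fibres decrease with `i`. -/
lemma of_limit {I : Type*} [LinearOrder I] [Nonempty I] {L : I → Type*}
    [∀ i, TopologicalSpace (L i)] [∀ i, T2Space (L i)] {R : ∀ i, L i ≃ₜ L i} {π : ∀ i, K → L i}
    (hL : ∀ i, MSubsystemsMinimal (R i)) (hc : ∀ i, Continuous (π i))
    (hπ : ∀ i x, π i (S x) = R i (π i x))
    (hmono : ∀ i j, i ≤ j → ∀ x y, π j x = π j y → π i x = π i y)
    (hsep : ∀ x y, (∀ i, π i x = π i y) → x = y) : MSubsystemsMinimal S := by
  intro Z hZ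
  obtain ⟨M, hMZ, hM⟩ := hZ.toIsSubsystem.exists_isMinimalSubsystem
  suffices Z ⊆ M by rwa [this.antisymm hMZ]
  intro z hz
  have hcl : ∀ i, IsClosed (M ∩ π i ⁻¹' {π i z}) := fun i =>
    hM.isClosed.inter (isClosed_singleton.preimage (hc i))
  obtain ⟨x, hx⟩ := IsCompact.nonempty_iInter_of_directed_nonempty_isCompact_isClosed
    (fun i => M ∩ π i ⁻¹' {π i z})
    (fun i j => ⟨max i j,
      fun x hx => ⟨hx.1, hmono _ _ (le_max_left i j) _ _ hx.2⟩,
      fun x hx => ⟨hx.1, hmono _ _ (le_max_right i j) _ _ hx.2⟩⟩)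
    (fun i => by
      have heq : π i '' M = π i '' Z := (hL i _ (hZ.image (hc i) (hπ i))).eq_of_subset
        (hM.toIsSubsystem.image (hc i) (hπ i)) (Set.image_mono hMZ)
      obtain ⟨x, hx, hxz⟩ : π i z ∈ π i '' M := by
        rw [heq]
        exact ⟨z, hz, rfl⟩
      exact ⟨x, hx, hxz⟩)
    (fun i => (hcl i).isCompact) hcl
  rw [Set.mem_iInter] at hx
  rw [← hsep x z fun i => (hx i).2]
  exact (hx (Classical.arbitrary I)).1

end MSubsystemsMinimal

/-! ### The transformation `τ_d` along extensions -/

namespace TDS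

variable {X Y : TDS.{u}} {π : X → Y}

instance (d : ℕ) : SecondCountableTopology (Fin d → X) :=
  UniformSpace.secondCountable_of_separable _

lemma IsExtension.tauPow_semiconj (h : IsExtension X Y π) (d : ℕ) (x : Fin d → X) :
    (fun i => π (tauPow X.T d x i)) = tauPow Y.T d (fun i => π (x i)) := by
  funext i
  exact_mod_cast zpow_apply_of_semiconj h.equivariant ((i : ℕ) + 1 : ℕ) (x i)

lemma IsExtension.continuous_pi (h : IsExtension X Y π) (d : ℕ) :
    Continuous fun (x : Fin d → X) i => π (x i) :=
  _root_.continuous_pi fun i => h.continuous.comp (continuous_apply i)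

/-- A proximal pair is proximal for every power `T ^ k`: if `Tⁿ x` and `Tⁿ y` are close enough, then
so are `T ^ (j + n) x` and `T ^ (j + n) y` for all `j < k`, and some `j + n` is a multiple of `k`. -/
lemma IsProximalPair.exists_dist_pow_lt {x y : X} (h : X.IsProximalPair x y) {k : ℕ} (hk : 0 < k)
    {ε : ℝ} (hε : 0 < ε) : ∃ m : ℕ, dist (((X.T ^ k) ^ m) x) (((X.T ^ k) ^ m) y) < ε := by
  have hcont : Continuous fun (z : X) (j : Fin k) => (X.T ^ (j : ℕ)) z :=
    _root_.continuous_pi fun j => (X.T ^ (j : ℕ)).continuous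
  obtain ⟨δ, hδ, hδε⟩ := Metric.uniformContinuous_iff.1
    (CompactSpace.uniformContinuous_of_continuous hcont) ε hε
  have hbdd : IsBoundedUnder (· ≤ ·) atTop fun n : ℕ => dist ((X.T ^ n) x) ((X.T ^ n) y) :=
    isBoundedUnder_of ⟨Metric.diam (Set.univ : Set X), fun n =>
      Metric.dist_le_diam_of_mem isCompact_univ.isBounded trivial trivial⟩
  obtain ⟨n, hn⟩ := (frequently_lt_of_liminf_lt hbdd.isCoboundedUnder_ge
    (lt_of_eq_of_lt h hδ)).exists
  -- `j` is the least `j ≥ 0` with `k ∣ j + n`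
  obtain ⟨j, m, hj⟩ : ∃ (j : Fin k) (m : ℕ), (j : ℕ) + n = k * m := by
    have hmod := Nat.mod_lt n hk
    have hdiv := Nat.div_add_mod n k
    by_cases h0 : n % k = 0
    · exact ⟨⟨0, hk⟩, n / k, by simp; omega⟩
    · exact ⟨⟨k - n % k, by omega⟩, n / k + 1, by simp only [mul_add, mul_one]; omega⟩
  have hlt := (dist_pi_lt_iff hε).1 (hδε hn) j
  refine ⟨m, ?_⟩
  rw [← pow_mul, ← hj, pow_add]
  exact hlt

lemma IsProximalExtension.eq_of_isMinimalPoint (h : IsProximalExtension X Y π) {k : ℕ}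
    (hk : 0 < k) {a b : X} (hab : π a = π b)
    (hmin : IsMinimalPoint ((X.T ^ k).prodCongr (X.T ^ k)) (a, b)) : a = b := by
  set P := (X.T ^ k).prodCongr (X.T ^ k)
  obtain ⟨p, hp, hpmin⟩ := (isClosed_closure (s := zOrbit P (a, b))).isCompact.exists_isMinOn
    ⟨_, subset_closure (self_mem_zOrbit _)⟩ (f := fun q : X × X => dist q.1 q.2)
    (continuous_fst.dist continuous_snd).continuousOn
  have hp0 : p.1 = p.2 := by
    by_contra hne
    obtain ⟨m, hm⟩ := (h.proximal a b hab).exists_dist_pow_lt hk (dist_pos.2 hne)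
    refine absurd hm (not_lt.2 ?_)
    have h1 := zpow_apply_of_semiconj (S := P) (R := X.T ^ k) (π := Prod.fst) (fun _ => rfl) m (a, b)
    have h2 := zpow_apply_of_semiconj (S := P) (R := X.T ^ k) (π := Prod.snd) (fun _ => rfl) m (a, b)
    have hle : dist p.1 p.2 ≤ dist ((P ^ (m : ℤ)) (a, b)).1 ((P ^ (m : ℤ)) (a, b)).2 :=
      hpmin (subset_closure ⟨m, rfl⟩)
    rw [h1, h2, zpow_natCast] at hle
    exact hle
  have hdiag : IsSubsystem P {q : X × X | q.1 = q.2} := by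
    refine isSubsystem_of_apply_mem_iff ⟨p, hp0⟩ (isClosed_eq continuous_fst continuous_snd) ?_
    rintro ⟨q, r⟩
    exact (X.T ^ k).injective.eq_iff
  have hmem : (a, b) ∈ closure (zOrbit P p) :=
    IsMinimalSubsystem.dense_orbit hmin p hp (subset_closure (self_mem_zOrbit _))
  exact hdiag.closure_zOrbit_subset hp0 hmem

lemma IsProximalExtension.mSubsystemsMinimal_tauPow (h : IsProximalExtension X Y π) {d : ℕ}
    (hY : MSubsystemsMinimal (tauPow Y.T d)) : MSubsystemsMinimal (tauPow X.T d) := by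
  refine hY.of_proximal (h.continuous_pi d) (h.tauPow_semiconj d) ?_
  intro a b hab hmin
  funext i
  refine h.eq_of_isMinimalPoint (Nat.succ_pos i) (congrFun hab i) ?_
  exact hmin.map (π := fun p : (Fin d → X) × (Fin d → X) => (p.1 i, p.2 i)) (by fun_prop)
    (fun _ => rfl)

lemma IsEquicontinuousExtension.mSubsystemsMinimal_tauPow (h : IsEquicontinuousExtension X Y π)
    {d : ℕ} (hY : MSubsystemsMinimal (tauPow Y.T d)) : MSubsystemsMinimal (tauPow X.T d) := by
  refine hY.of_distal (h.continuous_pi d) (h.tauPow_semiconj d) ?_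
  intro a b c hab hcl
  funext i
  by_contra hne
  obtain ⟨δ, hδ, hδε⟩ := h.equicontinuous _ (dist_pos.2 hne)
  have hopen : IsOpen {p : (Fin d → X) × (Fin d → X) | dist (p.1 i) (p.2 i) < δ} :=
    isOpen_lt (by fun_prop) continuous_const
  obtain ⟨_, hp, n, rfl⟩ := mem_closure_iff.1 hcl _ hopen (by simpa using hδ)
  have h1 := zpow_apply_of_semiconj (S := (tauPow X.T d).prodCongr (tauPow X.T d))
    (R := X.T ^ ((i : ℕ) + 1)) (π := fun p => p.1 i) (fun _ => rfl) n (a, b)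
  have h2 := zpow_apply_of_semiconj (S := (tauPow X.T d).prodCongr (tauPow X.T d))
    (R := X.T ^ ((i : ℕ) + 1)) (π := fun p => p.2 i) (fun _ => rfl) n (a, b)
  rw [Set.mem_ofPred_eq, h1, h2, ← zpow_natCast, ← zpow_mul] at hp
  -- equicontinuity, applied to the inverse power, brings the pair `(a i, b i)` back
  set N : ℤ := ((i : ℕ) + 1 : ℕ) * n
  have hfib : π ((X.T ^ N) (a i)) = π ((X.T ^ N) (b i)) := by
    rw [zpow_apply_of_semiconj h.equivariant, zpow_apply_of_semiconj h.equivariant]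
    exact congrArg _ (congrFun hab i)
  have hback := hδε _ _ hfib hp (-N)
  have hinv : ∀ z : X, (X.T ^ (-N)) ((X.T ^ N) z) = z := fun z => by
    rw [zpow_neg]
    exact (X.T ^ N).symm_apply_apply z
  rw [hinv, hinv] at hback
  exact lt_irrefl _ hback

lemma IsExtension.mSubsystemsMinimal_tauPow (h : IsExtension X Y π) {d : ℕ}
    (hX : MSubsystemsMinimal (tauPow X.T d)) : MSubsystemsMinimal (tauPow Y.T d) := by
  refine hX.of_factor (h.continuous_pi d) (fun y => ?_) (h.tauPow_semiconj d)
  choose x hx using fun i => h.surjective (y i)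
  exact ⟨x, funext hx⟩

lemma IsPITower.mSubsystemsMinimal_tauPow {η : Ordinal.{u}} {W : Ordinal.{u} → TDS.{u}}
    {pt : ∀ ι, W ι} {proj : ∀ ι κ, W κ → W ι} (h : IsPITower η W pt proj) (d : ℕ)
    (ι : Ordinal.{u}) (hι : ι ≤ η) : MSubsystemsMinimal (tauPow (W ι).T d) := by
  induction ι using Ordinal.limitRecOn with
  | zero =>
    have := h.trivial_zero
    exact .of_subsingleton
  | add_one ι ih =>
    have hlt : ι < η := (lt_add_one ι).trans_le hι
    have hstep := h.succ_step ι hlt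
    rw [Order.succ_eq_add_one] at hstep
    rcases hstep with hstep | hstep
    · exact hstep.mSubsystemsMinimal_tauPow (ih hlt.le)
    · exact hstep.mSubsystemsMinimal_tauPow (ih hlt.le)
  | limit ν hν ih =>
    have hext : ∀ ι : Set.Iio ν, IsExtension (W ν) (W ι) (proj ι ν) := fun ι =>
      h.isExtension ι ν (le_of_lt ι.2) hι
    have : Nonempty (Set.Iio ν) := ⟨⟨0, hν.bot_lt⟩⟩
    refine MSubsystemsMinimal.of_limit (I := Set.Iio ν) (L := fun ι => Fin d → W ι)
      (π := fun ι x i => proj ι ν (x i)) (fun ι => ih ι ι.2 ((le_of_lt ι.2).trans hι))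
      (fun ι => (hext ι).continuous_pi d) (fun ι => (hext ι).tauPow_semiconj d) ?_ ?_
    · intro ι κ hικ x y hxy
      funext i
      have hproj := h.proj_proj ι κ ν hικ (le_of_lt κ.2) hι
      change proj ι ν (x i) = proj ι ν (y i)
      rw [← hproj, ← hproj]
      exact congrArg _ (congrFun hxy i)
    · intro x y hxy
      funext i
      refine (h.limit_step ν hι hν (fun ι => proj ι ν (x i)) fun ι κ hικ =>
        h.proj_proj ι κ ν hικ (le_of_lt κ.2) hι _).unique (fun _ => rfl) fun ι => ?_
      exact (congrFun (hxy ι) i).symm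

end TDS

theorem theoremC (X : TDS.{u}) (hmin : X.IsMinimal) (hPI : X.IsPI) (d : ℕ) (hd : 2 ≤ d)
    (Z : Set (Fin d → X)) (hZ : IsMSubsystem (tauPow X.T d) Z) :
    IsMinimalSubsystem (tauPow X.T d) Z := by
  obtain ⟨X', θ, ⟨-, η, W, pt, proj, htower, e, he⟩, hθ⟩ := hPI
  have hiso : TDS.IsExtension (W η) X' e := ⟨e.continuous, e.surjective, he⟩
  exact hθ.toIsExtension.mSubsystemsMinimal_tauPow
    (hiso.mSubsystemsMinimal_tauPow (htower.mSubsystemsMinimal_tauPow d η le_rfl)) Z hZ
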